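/- A run of a word is a maximal weakly increasing block of consecutive letters, and a word is run-sorted if its runs occur in weakly increasing lexicographic order from left to right (a proper prefix being smaller). For $a,b\ge 0$ let $\mathrm{RSW}(a,b)$ be the set of run-sorted binary words with $a$ zeros and $b$ ones. For a permutation $\sigma\in S_n$, written $\sigma(1)\cdots\sigma(n)$, let $\operatorname{maj}(\sigma)=\sum_{j\,:\,\sigma(j)>\sigma(j+1)} j$. A biword is a finite, possibly empty, sequence of columns $\binom{u_1}{v_1},\dots,\binom{u_m}{v_m}$ of positive integers such that $u_i\le u_{i+1}$ for all $i<m$, and $v_i\le v_{i+1}$ whenever $u_i=u_{i+1}$; let $\mathrm{BW}(a,b)$ be the set of biwords with $\sum_i u_i=a$ and $\sum_i v_i=b$. **Proposition.** As formal power series in $q,t$ over $\mathbb Z$, $$1+\sum_{a,b\ge 1}|\mathrm{RSW}(a,b)|\,q^a t^b=\prod_{i,j\ge 1}\frac{1}{1-q^i t^j},$$ where the term $1=|\mathrm{RSW}(0,0)|$ counts the empty word and the product converges coefficientwise. Moreover, for all $a,b\ge 0$ that are either both zero or both positive: 1. there is a bijection $\mathrm{RSW}(a,b)\to\mathrm{BW}(a,b)$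 that sends $w$ to the biword whose multiset of columns consists of $\binom{u}{v}$ for each run of $w$, where $u$ is the number of zeros and $v$ the number of ones in that run; 2. $|\mathrm{RSW}(a,b)|$ equals the number of permutations $\sigma\in S_{a+b}$ with $\operatorname{maj}(\sigma)=a$ and $\operatorname{maj}(\sigma^{-1})=b$. -/

import Mathlib

open scoped MvPowerSeries.WithPiTopology

namespace RunSorted

/-- The runs of a word: its maximal weakly increasing blocks of consecutive letters,
in the order in which they occur (the word is cut exactly at its descents). -/
def runs {α : Type*} [LinearOrder α] (w : List α) : List (List α) :=
  w.splitBy (fun x y => decide (x ≤ y))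

/-- A word is run-sorted if its runs occur in (weakly increasing) lexicographic order;
`≤` on lists is the lexicographic order, in which a proper prefix is smaller. -/
def IsRunSorted {α : Type*} [LinearOrder α] (w : List α) : Prop :=
  (runs w).Pairwise (· ≤ ·)

/-- `RSW a b`: the run-sorted binary words with `a` zeros and `b` ones. -/
def RSW (a b : ℕ) : Set (List (Fin 2)) :=
  {w | w.count 0 = a ∧ w.count 1 = b ∧ IsRunSorted w}

theorem length_eq_count_add_count (w : List (Fin 2)) :
    w.length = w.count 0 + w.count 1 := by
  induction w with
  | nil => rfl
  | cons x w ih =>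
    fin_cases x <;> simp <;> omega

/-- `RSW a b` is finite, so that its cardinality `(RSW a b).ncard` is the true one. -/
theorem finite_RSW (a b : ℕ) : (RSW a b).Finite := by
  refine (List.finite_length_eq (Fin 2) (a + b)).subset ?_
  rintro w ⟨h0, h1, -⟩
  simp only [Set.mem_ofPred_eq]
  rw [length_eq_count_add_count, h0, h1]

/-- The word `c` of columns `(u, v)` is a biword: all entries are positive, the top row is
weakly increasing, and the bottom row weakly increases where the top row is constant. -/
def IsBiword (c : List (ℕ × ℕ)) : Prop :=
  (∀ x ∈ c, 0 < x.1 ∧ 0 < x.2) ∧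
    c.IsChain (fun x y => x.1 ≤ y.1 ∧ (x.1 = y.1 → x.2 ≤ y.2))

/-- `BW a b`: the biwords with top row of sum `a` and bottom row of sum `b`. -/
def BW (a b : ℕ) : Set (List (ℕ × ℕ)) :=
  {c | IsBiword c ∧ (c.map Prod.fst).sum = a ∧ (c.map Prod.snd).sum = b}

/-- The column of a run: (its number of zeros, its number of ones). -/
def column (r : List (Fin 2)) : ℕ × ℕ := (r.count 0, r.count 1)

/-- The descents of `σ`: with positions counted from `0`, those `i` with
`i + 1 < n` and `σ i > σ (i + 1)`. -/
def descents {n : ℕ} (σ : Equiv.Perm (Fin n)) : Finset (Fin n) :=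
  Finset.univ.filter (fun i => ∃ j : Fin n, (j : ℕ) = (i : ℕ) + 1 ∧ σ j < σ i)

/-- The major index: the sum of the descents, with positions counted from `1`. -/
def maj {n : ℕ} (σ : Equiv.Perm (Fin n)) : ℕ :=
  ∑ i ∈ descents σ, ((i : ℕ) + 1)

/-- `MIP a b`: the permutations `σ` of `a + b` letters with `maj σ = a` and `maj σ⁻¹ = b`. -/
def MIP (a b : ℕ) : Finset (Equiv.Perm (Fin (a + b))) :=
  Finset.univ.filter (fun σ => maj σ = a ∧ maj σ⁻¹ = b)

/-- `1 - q ^ i * t ^ j` as a formal power series over `ℤ`, with `q = X 0` and `t = X 1`. -/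
noncomputable def oneSub (i j : ℕ) : MvPowerSeries (Fin 2) ℤ :=
  1 - MvPowerSeries.X 0 ^ i * MvPowerSeries.X 1 ^ j

/-- `1 / (1 - q ^ i * t ^ j)`, the inverse of `oneSub i j` for `i ≥ 1`. -/
noncomputable def factor (i j : ℕ) : MvPowerSeries (Fin 2) ℤ :=
  MvPowerSeries.invOfUnit (oneSub i j) 1

theorem oneSub_mul_factor (i j : ℕ) (hi : 1 ≤ i) : oneSub i j * factor i j = 1 := by
  refine MvPowerSeries.mul_invOfUnit _ _ ?_
  have : i ≠ 0 := by omega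
  simp [oneSub, this]

/-- The formal power series `∑ |RSW a b| q ^ a t ^ b`, summed over the pairs `(a, b)` which are
either `(0, 0)` or have both entries positive. -/
noncomputable def genFun : MvPowerSeries (Fin 2) ℤ :=
  fun m => if (m 0 = 0 ↔ m 1 = 0) then ((RSW (m 0) (m 1)).ncard : ℤ) else 0

end RunSorted

namespace RunSorted

/-! Everything is compared with `ColMultisets a b`. A biword is the sorted listing of such a
multiset. A binary run is `0^u 1^v`, hence determined by its column, and a run-sorted word is
determined by the multiset of its runs. Conversely, runs with positive columns can be sorted and
concatenated: every junction reads `10`, a descent, so cutting at descents gives them back. In a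
run-sorted word using both letters, every run uses both (`column_pos_of_mem_runs`). The product
formula is then the expansion into geometric series, one factor per possible column.

For the major indices, fix `n ≥ a + b` and count in two ways the multisets of nonzero columns in `ℕ
× ℕ` with sum `(a, b)`. Separating the columns with a zero entry gives the convolution of
`ColMultisets` with two copies of the partition numbers. Padding with zeros to `n` columns and
sorting decreasingly gives a sequence encoded by a permutation `σ` and two partitions with at most
`n` parts, where `σ` contributes `(maj σ, maj σ⁻¹)` to the sum (`bijOn_colSeqOfPerm`, the
Garsia–Gessel encoding). Up to total degree `n` this is a convolution with the same partition
numbers, which cancel (`eq_of_convolution_eq`). -/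

/-! ### Sorted sequences and multisets -/

/-- The lexicographic order on columns. -/
def ColLE (x y : ℕ × ℕ) : Prop := x.1 ≤ y.1 ∧ (x.1 = y.1 → x.2 ≤ y.2)

instance : DecidableRel ColLE := fun x y => by unfold ColLE; infer_instance

instance : IsTrans (ℕ × ℕ) ColLE := ⟨fun x y z h h' => by unfold ColLE at *; omega⟩

instance : Std.Antisymm ColLE := ⟨fun x y h h' => by
  unfold ColLE at *; exact Prod.ext (by omega) (by omega)⟩

instance : Std.Total ColLE := ⟨fun x y => by unfold ColLE; omega⟩

/-- The converse of the lexicographic order on columns. -/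
def ColGE (x y : ℕ × ℕ) : Prop := ColLE y x

instance : DecidableRel ColGE := fun x y => by unfold ColGE; infer_instance

instance : IsTrans (ℕ × ℕ) ColGE := ⟨fun _ _ _ h h' => _root_.trans (r := ColLE) h' h⟩

instance : Std.Antisymm ColGE := ⟨fun _ _ h h' => antisymm (r := ColLE) h' h⟩

instance : Std.Total ColGE := ⟨fun x y => total_of ColLE y x⟩

/-- The multisets of columns with positive entries and sum `(a, b)`. -/
def ColMultisets (a b : ℕ) : Set (Multiset (ℕ × ℕ)) :=
  {m | (∀ x ∈ m, 0 < x.1 ∧ 0 < x.2) ∧ m.sum = (a, b)}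

theorem list_sum_prod (c : List (ℕ × ℕ)) :
    c.sum = ((c.map Prod.fst).sum, (c.map Prod.snd).sum) := by
  induction c with
  | nil => rfl
  | cons x c ih => simp [ih, Prod.ext_iff]

theorem bijOn_coe_BW (a b : ℕ) :
    Set.BijOn (fun c : List (ℕ × ℕ) => (c : Multiset (ℕ × ℕ))) (BW a b) (ColMultisets a b) := by
  refine ⟨?_, ?_, ?_⟩
  · rintro c ⟨⟨hpos, -⟩, h1, h2⟩
    refine ⟨fun x hx => hpos x (by simpa using hx), ?_⟩
    simp only [Multiset.sum_coe, list_sum_prod, h1, h2]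
  · rintro c ⟨⟨-, hc⟩, -⟩ d ⟨⟨-, hd⟩, -⟩ h
    exact List.Perm.eq_of_pairwise' (r := ColLE) (List.IsChain.pairwise (R := ColLE) hc)
      (List.IsChain.pairwise (R := ColLE) hd) (Multiset.coe_eq_coe.1 h)
  · rintro m ⟨hpos, hs⟩
    refine ⟨m.sort ColLE, ⟨⟨fun x hx => hpos x (by simpa using hx),
      (Multiset.pairwise_sort m ColLE).isChain⟩, ?_⟩, by simp⟩
    have : (m.sort ColLE).sum = (a, b) := by
      rw [← hs, ← Multiset.sum_coe, Multiset.sort_eq]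
    rw [list_sum_prod] at this
    exact Prod.ext_iff.1 this

/-! ### Runs of binary words -/

/-- The binary run with a given column. -/
def runWord (x : ℕ × ℕ) : List (Fin 2) := List.replicate x.1 0 ++ List.replicate x.2 1

theorem column_runWord (x : ℕ × ℕ) : column (runWord x) = x := by
  simp [column, runWord, List.count_replicate]

theorem isChain_runWord (x : ℕ × ℕ) : (runWord x).IsChain (· ≤ ·) := by
  refine List.Pairwise.isChain ?_
  rw [runWord, List.pairwise_append]
  refine ⟨List.pairwise_replicate.2 (by simp), List.pairwise_replicate.2 (by simp), ?_⟩
  intro a ha b hb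
  simp only [List.eq_of_mem_replicate ha, List.eq_of_mem_replicate hb]
  decide

theorem runWord_column {r : List (Fin 2)} (hr : r.IsChain (· ≤ ·)) : runWord (column r) = r := by
  refine List.Perm.eq_of_pairwise' (r := (· ≤ ·)) (isChain_runWord _).pairwise hr.pairwise ?_
  rw [List.perm_iff_count]
  intro x
  have := column_runWord (column r)
  simp only [column, Prod.mk.injEq] at this
  fin_cases x
  · exact this.1
  · exact this.2

theorem isChain_of_mem_runs {w r : List (Fin 2)} (hr : r ∈ runs w) : r.IsChain (· ≤ ·) := by
  simpa using List.isChain_of_mem_splitBy hr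

theorem runs_injOn : Set.InjOn (fun w : List (Fin 2) =>
    (((runs w).map column : List (ℕ × ℕ)) : Multiset (ℕ × ℕ))) {w | IsRunSorted w} := by
  intro w hw v hv h
  have hrec : ∀ u : List (Fin 2), ((runs u).map column).map runWord = runs u := by
    intro u
    rw [List.map_map]
    exact (List.map_congr_left fun r hr => runWord_column (isChain_of_mem_runs hr)).trans
      (List.map_id _)
  have hp : ((runs w).map column).Perm ((runs v).map column) := Multiset.coe_eq_coe.1 h
  have hp' := hp.map runWord
  rw [hrec, hrec] at hp'
  have := List.Perm.eq_of_pairwise' (r := (· ≤ ·)) hw hv hp'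
  rw [← List.flatten_splitBy (fun x y => decide (x ≤ y)) w,
    ← List.flatten_splitBy (fun x y => decide (x ≤ y)) v]
  exact congrArg List.flatten this

theorem sum_column_runs (w : List (Fin 2)) :
    ((runs w).map column).sum = (w.count 0, w.count 1) := by
  have hf : (runs w).flatten = w := List.flatten_splitBy _ w
  conv_rhs => rw [← hf]
  generalize runs w = L
  induction L with
  | nil => rfl
  | cons r L ih => simp [ih, column]

/-- Positivity makes every run begin with `0` and end with `1`, so in any concatenation the descents
are exactly the junctions. Sorting the runs lexicographically therefore does not disturb them. -/
theorem exists_isRunSorted_of_columns (m : Multiset (ℕ × ℕ)) (hm : ∀ x ∈ m, 0 < x.1 ∧ 0 < x.2) :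
    ∃ w : List (Fin 2), IsRunSorted w ∧
      (((runs w).map column : List (ℕ × ℕ)) : Multiset (ℕ × ℕ)) = m := by
  set L : List (List (Fin 2)) := (m.map runWord).sort (· ≤ ·) with hL
  have hmem : ∀ r ∈ L, ∃ x : ℕ × ℕ, 0 < x.1 ∧ 0 < x.2 ∧ runWord x = r := by
    intro r hr
    rw [hL, Multiset.mem_sort, Multiset.mem_map] at hr
    obtain ⟨x, hx, rfl⟩ := hr
    exact ⟨x, (hm x hx).1, (hm x hx).2, rfl⟩
  have hne : ∀ r ∈ L, ∀ h : r ≠ [], r.getLast h = 1 ∧ r.head h = 0 := by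
    intro r hr h
    obtain ⟨⟨u, v⟩, hu, hv, rfl⟩ := hmem r hr
    obtain ⟨u, rfl⟩ := Nat.exists_eq_succ_of_ne_zero hu.ne'
    obtain ⟨v, rfl⟩ := Nat.exists_eq_succ_of_ne_zero hv.ne'
    exact ⟨by simp [runWord], by simp [runWord, List.replicate_succ]⟩
  have hnil : ∀ r ∈ L, r ≠ [] := by
    intro r hr h
    obtain ⟨⟨u, v⟩, hu, hv, rfl⟩ := hmem r hr
    simp [runWord] at h
    simp [h.1] at hu
  have hruns : runs L.flatten = L := by
    refine List.splitBy_flatten (fun h => hnil _ h rfl) ?_ ?_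
    · intro r hr
      obtain ⟨x, -, -, rfl⟩ := hmem r hr
      simpa using isChain_runWord x
    · refine List.Pairwise.isChain (List.pairwise_of_forall_mem_list ?_)
      intro r hr s hs
      refine ⟨hnil r hr, hnil s hs, ?_⟩
      rw [(hne r hr _).1, (hne s hs _).2]
      decide
  refine ⟨L.flatten, ?_, ?_⟩
  · rw [IsRunSorted, hruns]
    exact Multiset.pairwise_sort _ _
  · rw [hruns, ← Multiset.map_coe, hL, Multiset.sort_eq, Multiset.map_map]
    simp [column_runWord]

theorem cons_le_cons_iff_lex {α : Type*} [LinearOrder α] {x y : α} {s t : List α} :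
    x :: s ≤ y :: t ↔ x < y ∨ x = y ∧ s ≤ t := by
  rw [← not_lt, ← not_lt, List.cons_lt_cons_iff]
  rcases lt_trichotomy x y with h | h | h
  · simp [h, h.ne', h.not_gt]
  · simp [h]
  · simp [h, h.ne', h.not_gt]

theorem one_notMem_of_le_replicate_zero {s : List (Fin 2)} {n : ℕ}
    (h : s ≤ List.replicate n 0) : (1 : Fin 2) ∉ s := by
  induction s generalizing n with
  | nil => simp
  | cons x s ih =>
    cases n with
    | zero => exact absurd h (by simp)
    | succ n =>
      rw [List.replicate_succ, cons_le_cons_iff_lex] at h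
      rcases h with h | ⟨rfl, h⟩
      · exact absurd h (by simp)
      · simpa using ih h

theorem eq_replicate_of_notMem {r : List (Fin 2)} {x y : Fin 2} (hxy : x ≠ y) (h : x ∉ r) :
    r = List.replicate r.length y := by
  refine List.eq_replicate_of_mem fun z hz => ?_
  have : z ≠ x := fun e => h (e ▸ hz)
  omega

/-- At a junction of consecutive runs `s ≤ t`, `s` ends with `1` and `t` begins with `0`. If `s` had
no `0`, it would begin with `1` and exceed `t`; if `t` had no `1`, then `s ≤ 0⋯0` could not contain
`1`. -/
theorem column_pos_of_mem_runs {w : List (Fin 2)} (hw : IsRunSorted w)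
    (h0 : 0 < w.count 0) (h1 : 0 < w.count 1) {r : List (Fin 2)} (hr : r ∈ runs w) :
    0 < (column r).1 ∧ 0 < (column r).2 := by
  have hf : (runs w).flatten = w := List.flatten_splitBy _ w
  have hadj : (runs w).IsChain fun s t => ∃ hs ht, decide (s.getLast hs ≤ t.head ht) = false :=
    List.isChain_getLast_head_splitBy (fun x y => decide (x ≤ y)) w
  have key : ∀ s t : List (Fin 2), s ≤ t → (∃ hs ht, decide (s.getLast hs ≤ t.head ht) = false) →
      ((0 : Fin 2) ∈ s ∧ (1 : Fin 2) ∈ s) ∧ ((0 : Fin 2) ∈ t ∧ (1 : Fin 2) ∈ t) := by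
    rintro s t hle ⟨hs, ht, hd⟩
    have hd' := of_decide_eq_false hd
    have h1s : (1 : Fin 2) ∈ s := by
      have : s.getLast hs = 1 := by omega
      exact this ▸ List.getLast_mem hs
    have h0t' : t.head ht = 0 := by omega
    have h0t : (0 : Fin 2) ∈ t := h0t' ▸ List.head_mem ht
    refine ⟨⟨?_, h1s⟩, h0t, ?_⟩
    · by_contra h
      have e := eq_replicate_of_notMem (y := 1) (by decide) h
      obtain ⟨n, hn⟩ : ∃ n, s.length = n + 1 :=
        Nat.exists_eq_succ_of_ne_zero (by simpa using hs)
      obtain ⟨y, t', rfl⟩ := List.exists_cons_of_ne_nil ht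
      simp only [List.head_cons] at h0t'
      rw [e, hn, List.replicate_succ, cons_le_cons_iff_lex, h0t'] at hle
      rcases hle with h | h
      · exact absurd h (by decide)
      · exact absurd h.1 (by decide)
    · by_contra h
      rw [eq_replicate_of_notMem (y := 0) (by decide) h] at hle
      exact one_notMem_of_le_replicate_zero hle h1s
  suffices h : (0 : Fin 2) ∈ r ∧ (1 : Fin 2) ∈ r by
    simpa [column, List.count_pos_iff] using h
  have hsort : (runs w).Pairwise (· ≤ ·) := hw
  obtain ⟨l₁, l₂, hl⟩ := List.append_of_mem hr
  rw [hl] at hadj hsort hf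
  -- A run is compared with its successor, or with its predecessor if it is last; a sole run is the
  -- whole word, where `h0` and `h1` apply.
  rcases l₂ with _ | ⟨t, l₂⟩
  · rcases List.eq_nil_or_concat l₁ with rfl | ⟨l₁, s, rfl⟩
    · simp at hf
      subst hf
      simpa [List.count_pos_iff] using And.intro h0 h1
    · rw [List.concat_eq_append, List.append_assoc] at hadj hsort
      exact (key s r (by simpa using (List.pairwise_append.1 hsort).2.1)
        (by simpa using hadj.right_of_append)).2
  · exact (key r t ((List.pairwise_cons.1 (List.pairwise_append.1 hsort).2.1).1 t (by simp))
      (List.isChain_cons_cons.1 hadj.right_of_append).1).1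

theorem bijOn_runs_RSW {a b : ℕ} (hab : a = 0 ↔ b = 0) :
    Set.BijOn (fun w : List (Fin 2) => (((runs w).map column : List (ℕ × ℕ)) : Multiset (ℕ × ℕ)))
      (RSW a b) (ColMultisets a b) := by
  refine ⟨?_, runs_injOn.mono fun w hw => hw.2.2, ?_⟩
  · rintro w ⟨h0, h1, hw⟩
    refine ⟨?_, ?_⟩
    · intro x hx
      simp only [Multiset.mem_coe, List.mem_map] at hx
      obtain ⟨r, hr, rfl⟩ := hx
      rcases Nat.eq_zero_or_pos a with rfl | ha
      · have : w = [] := by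
          rw [← List.length_eq_zero_iff, length_eq_count_add_count, h0, h1, hab.1 rfl]
        subst this
        simp [runs] at hr
      · exact column_pos_of_mem_runs hw (by omega) (by omega) hr
    · simp only [Multiset.sum_coe, sum_column_runs, h0, h1]
  · rintro m ⟨hpos, hs⟩
    obtain ⟨w, hw, rfl⟩ := exists_isRunSorted_of_columns m hpos
    rw [Multiset.sum_coe, sum_column_runs, Prod.mk.injEq] at hs
    exact ⟨w, ⟨hs.1, hs.2, hw⟩, rfl⟩

theorem exists_equiv_RSW_BW {a b : ℕ} (hab : a = 0 ↔ b = 0) :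
    ∃ e : RSW a b ≃ BW a b, ∀ w : RSW a b,
      List.Perm (e w : List (ℕ × ℕ)) ((runs (w : List (Fin 2))).map column) := by
  refine ⟨((bijOn_runs_RSW hab).equiv _).trans ((bijOn_coe_BW a b).equiv _).symm, fun w => ?_⟩
  rw [← Multiset.coe_eq_coe]
  have := ((bijOn_coe_BW a b).equiv _).apply_symm_apply ((bijOn_runs_RSW hab).equiv _ w)
  exact congrArg Subtype.val this

theorem ncard_RSW {a b : ℕ} (hab : a = 0 ↔ b = 0) :
    (RSW a b).ncard = (ColMultisets a b).ncard :=
  Set.ncard_congr' ((bijOn_runs_RSW hab).equiv _)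

/-! ### The product formula -/

theorem card_le_of_forall_pos {M : Type*} [AddCommMonoid M] (w : M →+ ℕ) (m : Multiset M)
    (h : ∀ x ∈ m, 0 < w x) : Multiset.card m ≤ w m.sum := by
  induction m using Multiset.induction_on with
  | empty => simp
  | cons x m ih =>
    have := h x (by simp)
    have := ih fun y hy => h y (by simp [hy])
    simp only [Multiset.card_cons, Multiset.sum_cons, map_add]
    omega

/-- Each member is at most `v`, and its multiplicity is at most the cardinality, hence at most `w
v`. -/
theorem finite_multisets_sum_eq {M : Type*} [AddCommMonoid M] [PartialOrder M]
    [IsOrderedAddMonoid M] [CanonicallyOrderedAdd M] [LocallyFiniteOrderBot M] (w : M →+ ℕ)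
    (hw : ∀ x, x ≠ 0 → 0 < w x) (v : M) : {m : Multiset M | 0 ∉ m ∧ m.sum = v}.Finite := by
  classical
  refine ((w v • (Finset.Iic v).val).powerset.toFinset.finite_toSet).subset ?_
  rintro m ⟨h0, rfl⟩
  simp only [Finset.mem_coe, Multiset.mem_toFinset, Multiset.mem_powerset]
  rw [Multiset.le_iff_count]
  intro x
  by_cases hx : x ∈ m
  · have h1 : Multiset.count x (Finset.Iic m.sum).val = 1 :=
      Multiset.count_eq_one_of_mem (Finset.nodup _) (by
        simpa using Multiset.single_le_sum (fun _ _ => zero_le) x hx)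
    rw [Multiset.count_nsmul, h1]
    have := card_le_of_forall_pos w m fun y hy => hw y (fun e => h0 (e ▸ hy))
    have := Multiset.count_le_card x m
    simp only [mul_one]
    omega
  · simp [Multiset.count_eq_zero_of_notMem hx]

/-- The sum of both entries of a column. -/
def colWeight : ℕ × ℕ →+ ℕ := AddMonoidHom.fst ℕ ℕ + AddMonoidHom.snd ℕ ℕ

theorem colWeight_pos (x : ℕ × ℕ) (hx : x ≠ 0) : 0 < colWeight x := by
  simp only [ne_eq, Prod.ext_iff, Prod.fst_zero, Prod.snd_zero] at hx
  simp only [colWeight, AddMonoidHom.add_apply, AddMonoidHom.coe_fst, AddMonoidHom.coe_snd]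
  omega

/-- The multisets of columns from `S` with sum `v`. -/
def MultisetsOn (S : Finset (ℕ × ℕ)) (v : ℕ × ℕ) : Set (Multiset (ℕ × ℕ)) :=
  {m | (∀ x ∈ m, x ∈ S) ∧ m.sum = v}

theorem finite_MultisetsOn {S : Finset (ℕ × ℕ)} (hS : 0 ∉ S) (v : ℕ × ℕ) :
    (MultisetsOn S v).Finite :=
  (finite_multisets_sum_eq colWeight colWeight_pos v).subset fun _ hm =>
    ⟨fun h => hS (hm.1 _ h), hm.2⟩

/-- Either `p` does not occur, or one copy of it can be removed, leaving a multiset that may still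
contain `p`. This is the coefficient form of the geometric series recursion. -/
theorem ncard_MultisetsOn_insert {S : Finset (ℕ × ℕ)} {p : ℕ × ℕ} (hp : p ∉ S)
    (hS : 0 ∉ insert p S) (v : ℕ × ℕ) :
    (MultisetsOn (insert p S) v).ncard =
      (MultisetsOn S v).ncard + if p ≤ v then (MultisetsOn (insert p S) (v - p)).ncard else 0 := by
  have hS' : 0 ∉ S := fun h => hS (Finset.mem_insert_of_mem h)
  have hsub : MultisetsOn S v ⊆ MultisetsOn (insert p S) v := fun m hm =>
    ⟨fun x hx => Finset.mem_insert_of_mem (hm.1 x hx), hm.2⟩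
  have hnot : ∀ m ∈ MultisetsOn (insert p S) v, p ∉ m → m ∈ MultisetsOn S v := fun m hm h =>
    ⟨fun x hx => (Finset.mem_insert.1 (hm.1 x hx)).resolve_left fun e => h (e ▸ hx), hm.2⟩
  split_ifs with hpv
  · have hun : MultisetsOn (insert p S) v =
        MultisetsOn S v ∪ (p ::ₘ ·) '' MultisetsOn (insert p S) (v - p) := by
      ext m
      constructor
      · intro hm
        by_cases h : p ∈ m
        · refine Or.inr ⟨m.erase p, ⟨fun x hx => hm.1 x (Multiset.mem_of_mem_erase hx), ?_⟩,
            Multiset.cons_erase h⟩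
          have := hm.2
          rw [← Multiset.cons_erase h, Multiset.sum_cons] at this
          rw [← this, add_tsub_cancel_left]
        · exact Or.inl (hnot m hm h)
      · rintro (hm | ⟨m, hm, rfl⟩)
        · exact hsub hm
        · refine ⟨fun x hx => ?_, ?_⟩
          · rcases Multiset.mem_cons.1 hx with rfl | hx
            · exact Finset.mem_insert_self _ _
            · exact hm.1 x hx
          · simp only [Multiset.sum_cons, hm.2, add_tsub_cancel_of_le hpv]
    rw [hun, Set.ncard_union_eq ?_ (finite_MultisetsOn hS' v)
      ((finite_MultisetsOn hS _).image _),
      Set.ncard_image_of_injective _ fun _ _ h => (Multiset.cons_inj_right p).1 h]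
    rw [Set.disjoint_left]
    rintro _ hm ⟨m, -, rfl⟩
    exact hp (hm.1 p (by simp))
  · congr 1
    refine Set.Subset.antisymm (fun m hm => hnot m hm fun h => hpv ?_) hsub
    rw [← hm.2]
    exact Multiset.single_le_sum (fun _ _ => zero_le) p h

/-- The generating function of the multisets of columns from `S`. -/
noncomputable def multisetSeries (S : Finset (ℕ × ℕ)) : MvPowerSeries (Fin 2) ℤ :=
  fun d => ((MultisetsOn S (d 0, d 1)).ncard : ℤ)

theorem oneSub_eq (i j : ℕ) :
    oneSub i j = 1 - MvPowerSeries.monomial (Finsupp.single 0 i + Finsupp.single 1 j) 1 := by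
  rw [oneSub, MvPowerSeries.X_pow_eq, MvPowerSeries.X_pow_eq, MvPowerSeries.monomial_mul_monomial,
    one_mul]

theorem oneSub_mul_multisetSeries {S : Finset (ℕ × ℕ)} {p : ℕ × ℕ} (hp : p ∉ S)
    (hS : 0 ∉ insert p S) :
    oneSub p.1 p.2 * multisetSeries (insert p S) = multisetSeries S := by
  ext d
  rw [oneSub_eq, sub_mul, one_mul, map_sub, MvPowerSeries.coeff_monomial_mul, one_mul]
  have hle : Finsupp.single (0 : Fin 2) p.1 + Finsupp.single 1 p.2 ≤ d ↔ p ≤ (d 0, d 1) := by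
    rw [Finsupp.le_def, Fin.forall_fin_two, Prod.le_def]
    simp
  have hsub : ((d - (Finsupp.single (0 : Fin 2) p.1 + Finsupp.single 1 p.2) : Fin 2 →₀ ℕ) 0,
      (d - (Finsupp.single (0 : Fin 2) p.1 + Finsupp.single 1 p.2) : Fin 2 →₀ ℕ) 1) = (d 0, d 1) - p := by
    ext <;> simp
  simp only [MvPowerSeries.coeff_apply, multisetSeries, hle, hsub]
  rw [ncard_MultisetsOn_insert hp hS]
  split_ifs <;> simp

theorem prod_factor {S : Finset (ℕ × ℕ)} (hS : ∀ p ∈ S, 1 ≤ p.1) :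
    ∏ p ∈ S, factor p.1 p.2 = multisetSeries S := by
  induction S using Finset.induction_on with
  | empty =>
    ext d
    rw [Finset.prod_empty, MvPowerSeries.coeff_one]
    have : d = 0 ↔ (0 : ℕ × ℕ) = (d 0, d 1) := by
      rw [Finsupp.ext_iff, Fin.forall_fin_two]
      simp [Prod.ext_iff, eq_comm]
    simp only [MvPowerSeries.coeff_apply, multisetSeries, MultisetsOn, Finset.notMem_empty,
      imp_false, ← Multiset.eq_zero_iff_forall_notMem, this]
    split_ifs with h
    · have : {m : Multiset (ℕ × ℕ) | m = 0 ∧ m.sum = (d 0, d 1)} = {0} := by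
        ext m
        simp only [Set.mem_ofPred_eq, Set.mem_singleton_iff, and_iff_left_iff_imp]
        rintro rfl
        rw [Multiset.sum_zero, h]
      simp [this]
    · have : {m : Multiset (ℕ × ℕ) | m = 0 ∧ m.sum = (d 0, d 1)} = ∅ := by
        ext m
        simp only [Set.mem_ofPred_eq, Set.mem_empty_iff_false, iff_false, not_and]
        rintro rfl
        rwa [Multiset.sum_zero]
      simp [this]
  | insert p S hp ih =>
    have h0 : 0 ∉ insert p S := fun h => absurd (hS 0 h) (by simp)
    rw [Finset.prod_insert hp, ih fun q hq => hS q (Finset.mem_insert_of_mem hq),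
      ← oneSub_mul_multisetSeries hp h0, ← mul_assoc, mul_comm (factor _ _),
      oneSub_mul_factor _ _ (hS p (Finset.mem_insert_self _ _)), one_mul]

/-- The inclusion of the columns with positive entries into all columns. -/
def posCol : ℕ+ × ℕ+ ↪ ℕ × ℕ :=
  ⟨fun p => (p.1, p.2), fun p q h => by simpa [Prod.ext_iff] using h⟩

/-- Accounts for the coefficients that `genFun` sets to zero. -/
theorem ColMultisets_eq_empty {a b : ℕ} (h : ¬(a = 0 ↔ b = 0)) : ColMultisets a b = ∅ := by
  rw [Set.eq_empty_iff_forall_notMem]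
  rintro m ⟨hpos, hs⟩
  rcases Multiset.empty_or_exists_mem m with rfl | ⟨x, hx⟩
  · simp only [Multiset.sum_zero, Prod.ext_iff, Prod.fst_zero, Prod.snd_zero] at hs
    omega
  · have hle := Multiset.single_le_sum (fun _ _ => zero_le) x hx
    have := hpos x hx
    rw [hs, Prod.le_def] at hle
    simp only at hle
    omega

theorem MultisetsOn_eq_ColMultisets {s : Finset (ℕ+ × ℕ+)} {a b : ℕ}
    (hs : ∀ p : ℕ+ × ℕ+, (p.1 : ℕ) ≤ a → (p.2 : ℕ) ≤ b → p ∈ s) :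
    MultisetsOn (s.map posCol) (a, b) = ColMultisets a b := by
  ext m
  refine ⟨fun hm => ⟨fun x hx => ?_, hm.2⟩, fun hm => ⟨fun x hx => ?_, hm.2⟩⟩
  · obtain ⟨p, -, rfl⟩ := Finset.mem_map.1 (hm.1 x hx)
    exact ⟨p.1.pos, p.2.pos⟩
  · have hle := Multiset.single_le_sum (fun _ _ => zero_le) x hx
    rw [hm.2, Prod.le_def] at hle
    exact Finset.mem_map.2 ⟨(⟨x.1, (hm.1 x hx).1⟩, ⟨x.2, (hm.1 x hx).2⟩),
      hs _ hle.1 hle.2, rfl⟩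

theorem coeff_genFun (d : Fin 2 →₀ ℕ) :
    MvPowerSeries.coeff d genFun = ((ColMultisets (d 0) (d 1)).ncard : ℤ) := by
  rw [MvPowerSeries.coeff_apply, genFun]
  split_ifs with h
  · rw [ncard_RSW h]
  · simp [ColMultisets_eq_empty h]

theorem hasProd_factor :
    HasProd (fun p : ℕ+ × ℕ+ => factor p.1 p.2) genFun := by
  rw [HasProd, MvPowerSeries.WithPiTopology.tendsto_iff_coeff_tendsto]
  intro d
  -- Each coefficient of the partial products is eventually constant: columns not below `(d 0, d 1)`
  -- cannot occur in a multiset of that sum.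
  refine tendsto_const_nhds.congr' ?_
  rw [SummationFilter.unconditional_filter]
  have hfin : {p : ℕ+ × ℕ+ | (p.1 : ℕ) ≤ d 0 ∧ (p.2 : ℕ) ≤ d 1}.Finite :=
    Set.Finite.of_injOn (f := posCol) (t := Set.Iic (d 0, d 1))
      (fun p hp => hp) posCol.injective.injOn (Set.finite_Iic _)
  filter_upwards [Filter.eventually_ge_atTop hfin.toFinset] with s hs
  have hprod : ∏ p ∈ s, factor p.1 p.2 = multisetSeries (s.map posCol) := by
    rw [← prod_factor, Finset.prod_map]
    · rfl
    · intro q hq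
      obtain ⟨p, -, rfl⟩ := Finset.mem_map.1 hq
      exact p.1.pos
  rw [hprod, coeff_genFun, MvPowerSeries.coeff_apply, multisetSeries, MultisetsOn_eq_ColMultisets]
  exact fun p h1 h2 => hs (by simpa using ⟨h1, h2⟩)

/-! ### Counting by convolution -/

/-- Adjoining zeros up to `n` elements keeps the sum, and deleting all zeros undoes it. -/
theorem ncard_padded {M : Type*} [AddCommMonoid M] (n : ℕ) (v : M)
    (h : ∀ m : Multiset M, 0 ∉ m → m.sum = v → Multiset.card m ≤ n) :
    {m : Multiset M | Multiset.card m = n ∧ m.sum = v}.ncard =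
      {m : Multiset M | 0 ∉ m ∧ m.sum = v}.ncard := by
  classical
  have hbij : Set.BijOn (fun m : Multiset M => m + Multiset.replicate (n - Multiset.card m) 0)
      {m : Multiset M | 0 ∉ m ∧ m.sum = v} {m | Multiset.card m = n ∧ m.sum = v} := by
    refine ⟨?_, ?_, ?_⟩
    · rintro m ⟨h0, hs⟩
      have := h m h0 hs
      simp [hs, this]
    · rintro m ⟨hm, -⟩ m' ⟨hm', -⟩ he
      have key : ∀ (m : Multiset M) (k : ℕ), 0 ∉ m →
          (m + Multiset.replicate k 0).filter (· ≠ 0) = m := by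
        intro m k hm
        rw [Multiset.filter_add, Multiset.filter_eq_self.2 fun x hx => ne_of_mem_of_not_mem hx hm,
          Multiset.filter_eq_nil.2 fun x hx => by simpa using Multiset.eq_of_mem_replicate hx,
          add_zero]
      have := congrArg (Multiset.filter (· ≠ 0)) he
      simpa only [key m _ hm, key m' _ hm'] using this
    · rintro m ⟨hc, hs⟩
      have hsplit : m.filter (· ≠ 0) + Multiset.replicate (m.count 0) 0 = m := by
        rw [← Multiset.filter_eq', add_comm]
        exact Multiset.filter_add_not _ _
      have hcard := congrArg Multiset.card hsplit
      rw [Multiset.card_add, Multiset.card_replicate, hc] at hcard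
      refine ⟨m.filter (· ≠ 0), ⟨by simp, ?_⟩, ?_⟩
      · rw [← hs]
        conv_rhs => rw [← hsplit]
        simp
      · conv_rhs => rw [← hsplit]
        simp only
        congr 2
        omega
  exact (Set.ncard_congr' (hbij.equiv _)).symm

theorem ncard_convolution {K X : Type*} (P : Set K) (Q : Set X) (s : K → ℕ × ℕ) (t : X → ℕ)
    (hP : ∀ v, {k | k ∈ P ∧ s k = v}.Finite) (hQ : ∀ i, {x | x ∈ Q ∧ t x = i}.Finite) (a b : ℕ) :
    {z : K × X × X | z.1 ∈ P ∧ z.2.1 ∈ Q ∧ z.2.2 ∈ Q ∧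
      s z.1 + (t z.2.1, t z.2.2) = (a, b)}.ncard =
    ∑ i ∈ Finset.HasAntidiagonal.antidiagonal a, ∑ j ∈ Finset.HasAntidiagonal.antidiagonal b,
      {k | k ∈ P ∧ s k = (i.1, j.1)}.ncard *
        ({x | x ∈ Q ∧ t x = i.2}.ncard * {x | x ∈ Q ∧ t x = j.2}.ncard) := by
  classical
  have hset : {z : K × X × X | z.1 ∈ P ∧ z.2.1 ∈ Q ∧ z.2.2 ∈ Q ∧
      s z.1 + (t z.2.1, t z.2.2) = (a, b)} =
      ((Finset.HasAntidiagonal.antidiagonal a ×ˢ Finset.HasAntidiagonal.antidiagonal b).biUnion fun p =>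
        (hP (p.1.1, p.2.1)).toFinset ×ˢ (hQ p.1.2).toFinset ×ˢ (hQ p.2.2).toFinset :
          Finset (K × X × X)) := by
    ext ⟨k, x, y⟩
    simp only [Set.mem_ofPred_eq, Finset.coe_biUnion, Set.mem_iUnion, Finset.mem_coe,
      Finset.mem_product, Finset.HasAntidiagonal.mem_antidiagonal, Set.Finite.mem_toFinset, exists_prop,
      Prod.exists, Prod.ext_iff, Prod.fst_add, Prod.snd_add]
    constructor
    · rintro ⟨hk, hx, hy, h1, h2⟩
      exact ⟨_, _, _, _, ⟨h1, h2⟩, ⟨hk, rfl, rfl⟩, ⟨hx, rfl⟩, ⟨hy, rfl⟩⟩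
    · rintro ⟨_, _, _, _, ⟨h1, h2⟩, ⟨hk, rfl, rfl⟩, ⟨hx, rfl⟩, ⟨hy, rfl⟩⟩
      exact ⟨hk, hx, hy, h1, h2⟩
  rw [hset, Set.ncard_coe_finset, Finset.card_biUnion, Finset.sum_product]
  · refine Finset.sum_congr rfl fun i _ => Finset.sum_congr rfl fun j _ => ?_
    rw [Finset.card_product, Finset.card_product, Set.ncard_eq_toFinset_card _ (hP _),
      Set.ncard_eq_toFinset_card _ (hQ _), Set.ncard_eq_toFinset_card _ (hQ _)]
  · intro p _ q _ hpq
    rw [Function.onFun, Finset.disjoint_left]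
    rintro ⟨k, x, y⟩ h h'
    simp only [Finset.mem_product, Set.Finite.mem_toFinset, Set.mem_ofPred_eq] at h h'
    obtain ⟨⟨-, h1⟩, ⟨-, h2⟩, -, h3⟩ := h
    obtain ⟨⟨-, h1'⟩, ⟨-, h2'⟩, -, h3'⟩ := h'
    rw [h1, Prod.mk.injEq] at h1'
    exact hpq (Prod.ext (Prod.ext h1'.1 (h2.symm.trans h2')) (Prod.ext h1'.2 (h3.symm.trans h3')))

/-- Since `p 0 = 1`, the convolution at `(a, b)` is the value at `(a, b)` plus terms involving only
values of smaller total degree, which agree by induction. -/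
theorem eq_of_convolution_eq (A C : ℕ → ℕ → ℕ) (p : ℕ → ℕ) (hp : p 0 = 1) (n : ℕ)
    (h : ∀ a b, a + b ≤ n →
      ∑ i ∈ Finset.HasAntidiagonal.antidiagonal a, ∑ j ∈ Finset.HasAntidiagonal.antidiagonal b, A i.1 j.1 * (p i.2 * p j.2) =
      ∑ i ∈ Finset.HasAntidiagonal.antidiagonal a, ∑ j ∈ Finset.HasAntidiagonal.antidiagonal b, C i.1 j.1 * (p i.2 * p j.2))
    (a b : ℕ) (hab : a + b ≤ n) : A a b = C a b := by
  induction hk : a + b using Nat.strong_induction_on generalizing a b with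
  | _ k ih =>
    have hsum := h a b hab
    rw [← Finset.sum_product', ← Finset.sum_product'] at hsum
    have hmem : ((a, 0), (b, 0)) ∈ Finset.HasAntidiagonal.antidiagonal a ×ˢ Finset.HasAntidiagonal.antidiagonal b := by simp
    rw [← Finset.add_sum_erase _ _ hmem, ← Finset.add_sum_erase _ _ hmem] at hsum
    have hrest : ∀ q ∈ (Finset.HasAntidiagonal.antidiagonal a ×ˢ Finset.HasAntidiagonal.antidiagonal b).erase ((a, 0), (b, 0)),
        A q.1.1 q.2.1 * (p q.1.2 * p q.2.2) = C q.1.1 q.2.1 * (p q.1.2 * p q.2.2) := by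
      rintro ⟨⟨i, i'⟩, j, j'⟩ hq
      simp only [Finset.mem_erase, Finset.mem_product, Finset.HasAntidiagonal.mem_antidiagonal, ne_eq,
        Prod.mk.injEq] at hq
      simp only
      rw [ih (i + j) (by omega) i j (by omega) rfl]
    rw [Finset.sum_congr rfl hrest] at hsum
    simpa [hp] using Nat.add_right_cancel hsum

/-- Joins the columns with positive entries to those with a zero in the bottom or top row. -/
def joinCols (z : Multiset (ℕ × ℕ) × Multiset ℕ × Multiset ℕ) : Multiset (ℕ × ℕ) :=
  z.1 + (z.2.1.map fun u => (u, 0)) + z.2.2.map fun v => (0, v)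

theorem sum_joinCols (z : Multiset (ℕ × ℕ) × Multiset ℕ × Multiset ℕ) :
    (joinCols z).sum = z.1.sum + (z.2.1.sum, z.2.2.sum) := by
  obtain ⟨c, x, y⟩ := z
  have h1 : (x.map fun u => ((u, 0) : ℕ × ℕ)).sum = (x.sum, 0) :=
    (map_multiset_sum (AddMonoidHom.inl ℕ ℕ) x).symm
  have h2 : (y.map fun v => ((0, v) : ℕ × ℕ)).sum = (0, y.sum) :=
    (map_multiset_sum (AddMonoidHom.inr ℕ ℕ) y).symm
  simp [joinCols, h1, h2, add_assoc]

theorem exists_joinCols_eq (m : Multiset (ℕ × ℕ)) (hm : 0 ∉ m) :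
    ∃ z : Multiset (ℕ × ℕ) × Multiset ℕ × Multiset ℕ,
      (∀ x ∈ z.1, 0 < x.1 ∧ 0 < x.2) ∧ 0 ∉ z.2.1 ∧ 0 ∉ z.2.2 ∧ joinCols z = m := by
  induction m using Multiset.induction_on with
  | empty => exact ⟨(0, 0, 0), by simp [joinCols]⟩
  | cons q m ih =>
    obtain ⟨⟨c, x, y⟩, hc, hx, hy, rfl⟩ := ih fun h => hm (by simp [h])
    obtain ⟨u, v⟩ := q
    have h0 : ¬(u = 0 ∧ v = 0) := fun h => hm (by simp [h.1, h.2, Prod.ext_iff])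
    simp only at hc hx hy
    rcases Nat.eq_zero_or_pos u with rfl | hu
    · refine ⟨(c, x, v ::ₘ y), hc, hx, ?_, ?_⟩
      · simp only [Multiset.mem_cons, not_or]
        exact ⟨by omega, hy⟩
      · simp [joinCols]
    · rcases Nat.eq_zero_or_pos v with rfl | hv
      · refine ⟨(c, u ::ₘ x, y), hc, ?_, hy, ?_⟩
        · simp only [Multiset.mem_cons, not_or]
          exact ⟨by omega, hx⟩
        · simp [joinCols]
      · refine ⟨((u, v) ::ₘ c, x, y), ?_, hx, hy, by simp [joinCols]⟩
        intro q hq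
        rcases Multiset.mem_cons.1 hq with rfl | hq
        · exact ⟨hu, hv⟩
        · exact hc q hq

/-- The three parts are recovered by filtering on which entries vanish. -/
theorem joinCols_injOn : Set.InjOn joinCols
    {z | (∀ x ∈ z.1, 0 < x.1 ∧ 0 < x.2) ∧ 0 ∉ z.2.1 ∧ 0 ∉ z.2.2} := by
  have key : ∀ z : Multiset (ℕ × ℕ) × Multiset ℕ × Multiset ℕ,
      ((∀ x ∈ z.1, 0 < x.1 ∧ 0 < x.2) ∧ 0 ∉ z.2.1 ∧ 0 ∉ z.2.2) →
      (joinCols z).filter (fun q => 0 < q.1 ∧ 0 < q.2) = z.1 ∧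
      ((joinCols z).filter (fun q => q.2 = 0)).map Prod.fst = z.2.1 ∧
      ((joinCols z).filter (fun q => q.1 = 0)).map Prod.snd = z.2.2 := by
    rintro ⟨c, x, y⟩ ⟨hc, hx, hy⟩
    simp only at hc hx hy
    have e1 : c.filter (fun q => 0 < q.1 ∧ 0 < q.2) = c := Multiset.filter_eq_self.2 hc
    have e2 : c.filter (fun q => q.2 = 0) = 0 :=
      Multiset.filter_eq_nil.2 fun q hq => (hc q hq).2.ne'
    have e3 : c.filter (fun q => q.1 = 0) = 0 :=
      Multiset.filter_eq_nil.2 fun q hq => (hc q hq).1.ne'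
    have e4 : x.filter (fun u => u = 0) = 0 :=
      Multiset.filter_eq_nil.2 fun q hq e => hx (e ▸ hq)
    have e5 : y.filter (fun u => u = 0) = 0 :=
      Multiset.filter_eq_nil.2 fun q hq e => hy (e ▸ hq)
    simp [joinCols, Multiset.filter_map, e1, e2, e3, e4, e5]
  intro z hz z' hz' h
  have k := key z hz
  have k' := key z' hz'
  rw [h] at k
  exact Prod.ext (k.1.symm.trans k'.1)
    (Prod.ext (k.2.1.symm.trans k'.2.1) (k.2.2.symm.trans k'.2.2))

theorem ncard_multisets_sum_eq (a b : ℕ) :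
    {m : Multiset (ℕ × ℕ) | 0 ∉ m ∧ m.sum = (a, b)}.ncard =
    ∑ i ∈ Finset.HasAntidiagonal.antidiagonal a, ∑ j ∈ Finset.HasAntidiagonal.antidiagonal b,
      (ColMultisets i.1 j.1).ncard *
        ({m : Multiset ℕ | 0 ∉ m ∧ m.sum = i.2}.ncard *
          {m : Multiset ℕ | 0 ∉ m ∧ m.sum = j.2}.ncard) := by
  have hfin : ∀ v, {c : Multiset (ℕ × ℕ) | c ∈ {c : Multiset (ℕ × ℕ) | ∀ x ∈ c, 0 < x.1 ∧ 0 < x.2} ∧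
      c.sum = v}.Finite := fun v =>
    (finite_multisets_sum_eq colWeight colWeight_pos v).subset fun m hm =>
      ⟨fun h => absurd (hm.1 0 h).1 (by simp), hm.2⟩
  have hfin' : ∀ i, {m : Multiset ℕ | m ∈ {m : Multiset ℕ | 0 ∉ m} ∧ m.sum = i}.Finite :=
    finite_multisets_sum_eq (AddMonoidHom.id ℕ) fun x hx => Nat.pos_of_ne_zero hx
  refine Eq.trans ?_ (ncard_convolution {c : Multiset (ℕ × ℕ) | ∀ x ∈ c, 0 < x.1 ∧ 0 < x.2}
    {m : Multiset ℕ | 0 ∉ m} Multiset.sum Multiset.sum hfin hfin' a b)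
  refine (Set.ncard_congr' (Set.BijOn.equiv joinCols ⟨?_, ?_, ?_⟩)).symm
  · rintro z ⟨hc, hx, hy, hs⟩
    refine ⟨?_, by rw [sum_joinCols, hs]⟩
    simp only [joinCols, Multiset.mem_add, Multiset.mem_map, not_or]
    refine ⟨⟨fun h => absurd (hc 0 h).1 (by simp), ?_⟩, ?_⟩
    · rintro ⟨u, hu, h⟩
      obtain rfl : u = 0 := (Prod.ext_iff.1 h).1
      exact hx hu
    · rintro ⟨u, hu, h⟩
      obtain rfl : u = 0 := (Prod.ext_iff.1 h).2
      exact hy hu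
  · refine joinCols_injOn.mono ?_
    rintro z ⟨hc, hx, hy, -⟩
    exact ⟨hc, hx, hy⟩
  · rintro m ⟨hm, hs⟩
    obtain ⟨z, hc, hx, hy, rfl⟩ := exists_joinCols_eq m hm
    exact ⟨z, ⟨hc, hx, hy, by rw [← sum_joinCols, hs]⟩, rfl⟩

/-! ### Bipartite partitions and pairs of major indices -/

theorem bijOn_ofFn {α : Type*} (r : α → α → Prop) [DecidableRel r] [IsTrans α r]
    [Std.Antisymm r] [Std.Total r] (n : ℕ) :
    Set.BijOn (fun h : Fin n → α => (List.ofFn h : Multiset α))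
      {h | ∀ i j, i < j → r (h i) (h j)} {m | Multiset.card m = n} := by
  refine ⟨fun h _ => by simp, ?_, ?_⟩
  · intro h hh h' hh' e
    exact List.ofFn_injective (List.Perm.eq_of_pairwise' (r := r) (List.pairwise_ofFn.2 hh)
      (List.pairwise_ofFn.2 hh') (Multiset.coe_eq_coe.1 e))
  · rintro m rfl
    have hlen := Multiset.length_sort (s := m) r
    have hofFn : List.ofFn (fun i : Fin (Multiset.card m) =>
        (m.sort r).get (i.cast hlen.symm)) = m.sort r := by
      refine List.ext_get (by simp) fun k h1 h2 => by simp
    refine ⟨fun i => (m.sort r).get (i.cast hlen.symm), fun i j hij => ?_, ?_⟩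
    · exact List.pairwise_iff_get.1 (Multiset.pairwise_sort m r) _ _ (by simpa using hij)
    · simp only [hofFn, Multiset.sort_eq]

theorem ncard_sorted_sum_eq {α : Type*} [AddCommMonoid α] (r : α → α → Prop) [DecidableRel r]
    [IsTrans α r] [Std.Antisymm r] [Std.Total r] (n : ℕ) (v : α) :
    {h : Fin n → α | (∀ i j, i < j → r (h i) (h j)) ∧ ∑ i, h i = v}.ncard =
      {m : Multiset α | Multiset.card m = n ∧ m.sum = v}.ncard := by
  obtain ⟨h1, h2, h3⟩ := bijOn_ofFn r n
  refine Set.ncard_congr' (Set.BijOn.equiv (fun h => (List.ofFn h : Multiset α)) ⟨?_, ?_, ?_⟩)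
  · rintro h ⟨hh, hs⟩
    exact ⟨h1 hh, by simpa [List.sum_ofFn] using hs⟩
  · exact h2.mono fun h hh => hh.1
  · rintro m ⟨hm, hs⟩
    obtain ⟨h, hh, rfl⟩ := h3 hm
    exact ⟨h, ⟨hh, by simpa [List.sum_ofFn] using hs⟩, rfl⟩

/-- `f` is weakly decreasing, and strictly so across the inversions of `σ`. -/
def Compat {n : ℕ} (σ : Equiv.Perm (Fin n)) (f : Fin n → ℕ) : Prop :=
  Antitone f ∧ ∀ i j, i < j → f i = f j → σ i < σ j

/-- The number of descents of `σ` at or after a position. -/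
def descentsFrom {n : ℕ} (σ : Equiv.Perm (Fin n)) (i : Fin n) : ℕ :=
  ((descents σ).filter (i ≤ ·)).card

/-- Double counting: a descent at the 0-based position `d` is seen from the `d + 1` positions `i ≤
d`. -/
theorem sum_descentsFrom {n : ℕ} (σ : Equiv.Perm (Fin n)) : ∑ i, descentsFrom σ i = maj σ := by
  simp only [descentsFrom, maj, Finset.card_filter]
  rw [Finset.sum_comm]
  refine Finset.sum_congr rfl fun d _ => ?_
  rw [← Finset.card_filter, ← Fin.card_Iic]
  congr 1
  ext i
  simp

theorem fin_rel_of_le {n : ℕ} {R : Fin n → Fin n → Prop} (hrefl : ∀ i, R i i)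
    (htrans : ∀ i j k, R i j → R j k → R i k)
    (hsucc : ∀ i j : Fin n, (j : ℕ) = i + 1 → R i j) {i j : Fin n} (hij : i ≤ j) : R i j := by
  obtain ⟨i, hi⟩ := i
  obtain ⟨j, hj⟩ := j
  rw [Fin.mk_le_mk] at hij
  induction j, hij using Nat.le_induction with
  | base => exact hrefl _
  | succ k hk ih => exact htrans _ _ _ (ih (by omega)) (hsucc ⟨k, by omega⟩ ⟨k + 1, hj⟩ rfl)

theorem descentsFrom_succ {n : ℕ} (σ : Equiv.Perm (Fin n)) {i j : Fin n} (hij : (j : ℕ) = i + 1) :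
    descentsFrom σ i = descentsFrom σ j + if σ j < σ i then 1 else 0 := by
  have hmem : i ∈ descents σ ↔ σ j < σ i := by
    simp only [descents, Finset.mem_filter, Finset.mem_univ, true_and]
    refine ⟨?_, fun h => ⟨j, hij, h⟩⟩
    rintro ⟨k, hk, h⟩
    have : k = j := Fin.ext (by omega)
    exact this ▸ h
  have hset : (descents σ).filter (i ≤ ·) =
      (descents σ).filter (j ≤ ·) ∪ (descents σ).filter (i = ·) := by
    ext d
    simp only [Finset.mem_filter, Finset.mem_union, Fin.le_def, Fin.ext_iff, hij]
    constructor
    · rintro ⟨h, h'⟩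
      rcases Nat.lt_or_ge i d with h'' | h''
      · exact Or.inl ⟨h, h''⟩
      · exact Or.inr ⟨h, by omega⟩
    · rintro (⟨h, h'⟩ | ⟨h, h'⟩)
      · exact ⟨h, by omega⟩
      · exact ⟨h, by omega⟩
  rw [descentsFrom, hset, Finset.card_union_of_disjoint, descentsFrom, Finset.filter_eq]
  · simp only [hmem]
    split_ifs <;> simp
  · rw [Finset.disjoint_left]
    intro d h h'
    simp only [Finset.mem_filter, Fin.le_def, Fin.ext_iff] at h h'
    omega

/-- `descentsFrom σ` is the least compatible sequence: it drops by one exactly at the descents,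
where compatibility forces a strict drop. Subtracting it leaves an arbitrary partition. -/
theorem bijOn_add_descentsFrom {n : ℕ} (σ : Equiv.Perm (Fin n)) :
    Set.BijOn (fun l : Fin n → ℕ => l + descentsFrom σ) {l | Antitone l} {f | Compat σ f} := by
  have hstep : ∀ i j : Fin n, i ≤ j → descentsFrom σ j ≤ descentsFrom σ i ∧
      (descentsFrom σ i = descentsFrom σ j → σ i ≤ σ j) := by
    intro i j hij
    refine fin_rel_of_le (R := fun i j => descentsFrom σ j ≤ descentsFrom σ i ∧
      (descentsFrom σ i = descentsFrom σ j → σ i ≤ σ j)) (fun i => ⟨le_rfl, fun _ => le_rfl⟩)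
      ?_ ?_ hij
    · rintro i j k ⟨h1, h2⟩ ⟨h3, h4⟩
      exact ⟨h3.trans h1, fun h => (h2 (by omega)).trans (h4 (by omega))⟩
    · intro i j hij
      rw [descentsFrom_succ σ hij]
      refine ⟨by omega, fun h => ?_⟩
      by_contra hlt
      rw [if_pos (not_le.1 hlt)] at h
      omega
  refine ⟨?_, fun l _ l' _ h => add_right_cancel h, ?_⟩
  · intro l hl
    refine ⟨fun i j hij => add_le_add (hl hij) (hstep i j hij).1, fun i j hij h => ?_⟩
    have h1 := hl hij.le
    have h2 := hstep i j hij.le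
    simp only [Pi.add_apply] at h
    exact lt_of_le_of_ne (h2.2 (by omega)) fun e => hij.ne (σ.injective e)
  · rintro f ⟨hf, hf'⟩
    -- This says that `f - descentsFrom σ` is weakly decreasing, written without truncated
    -- subtraction.
    have hdiff : ∀ i j : Fin n, i ≤ j → descentsFrom σ i + f j ≤ f i + descentsFrom σ j := by
      intro i j hij
      refine fin_rel_of_le (R := fun i j => descentsFrom σ i + f j ≤ f i + descentsFrom σ j)
        (fun i => by omega) (fun i j k _ _ => by omega) (fun i j hij => ?_) hij
      have hlt : i < j := by rw [Fin.lt_def]; omega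
      have h1 := hf hlt.le
      rw [descentsFrom_succ σ hij]
      split_ifs with h
      · have : f i ≠ f j := fun e => (hf' i j hlt e).not_gt h
        omega
      · omega
    have hle : ∀ i, descentsFrom σ i ≤ f i := by
      intro i
      have hi := i.isLt
      -- The last position is never a descent, so `hdiff` against it bounds `descentsFrom σ i` by `f
      -- i`.
      have hlast : i ≤ (⟨n - 1, by omega⟩ : Fin n) := by rw [Fin.le_def]; simp only; omega
      have h0 : descentsFrom σ (⟨n - 1, by omega⟩ : Fin n) = 0 := by
        rw [descentsFrom, Finset.card_eq_zero, Finset.filter_eq_empty_iff]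
        intro d hd hle
        simp only [descents, Finset.mem_filter, Finset.mem_univ, true_and] at hd
        obtain ⟨j, hj, -⟩ := hd
        rw [Fin.le_def] at hle
        simp only at hle
        omega
      have := hdiff _ _ hlast
      omega
    refine ⟨fun i => f i - descentsFrom σ i, fun i j hij => ?_, ?_⟩
    · have := hdiff i j hij
      have := hle i
      have := hle j
      simp only
      omega
    · funext i
      simp [hle i]

/-- `Tuple.sort` is the stable sort, with ties kept in index order, which is the tie condition in
`Compat`; the order dual makes it sort decreasingly. Thus `σ` is determined by the rearranged row `g
∘ σ`. -/
theorem compat_inv_iff_eq_sort {n : ℕ} (σ : Equiv.Perm (Fin n)) (g : Fin n → ℕ) :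
    Compat σ⁻¹ g ↔ σ⁻¹ = Tuple.sort (OrderDual.toDual ∘ g ∘ σ) := by
  rw [Tuple.eq_sort_iff]
  have : (OrderDual.toDual ∘ g ∘ σ) ∘ (σ⁻¹ : Equiv.Perm (Fin n)) = OrderDual.toDual ∘ g := by
    funext i
    simp
  rw [this, Compat, monotone_toDual_comp_iff]
  simp

/-- The sequence of columns with top row `z.2.1` and bottom row `z.2.2` rearranged by `z.1`. -/
def colSeq {n : ℕ} (z : Equiv.Perm (Fin n) × (Fin n → ℕ) × (Fin n → ℕ)) : Fin n → ℕ × ℕ :=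
  fun i => (z.2.1 i, z.2.2 (z.1 i))

/-- The inverse takes `σ⁻¹` to be the stable decreasing sort of the bottom row. By `hlt`, bottom
entries at `i < j` weakly decrease exactly when `σ i < σ j`, so compatibility of the top row with
`σ` is the lexicographic tie condition. -/
theorem bijOn_colSeq (n : ℕ) :
    Set.BijOn colSeq {z : Equiv.Perm (Fin n) × (Fin n → ℕ) × (Fin n → ℕ) |
        Compat z.1 z.2.1 ∧ Compat z.1⁻¹ z.2.2}
      {h | ∀ i j, i < j → ColGE (h i) (h j)} := by
  have hlt : ∀ (σ : Equiv.Perm (Fin n)) (g : Fin n → ℕ), Compat σ⁻¹ g → ∀ i j, i < j →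
      (g (σ j) ≤ g (σ i) ↔ σ i < σ j) := by
    rintro σ g ⟨hg, hg'⟩ i j hij
    refine ⟨fun h => ?_, fun h => hg h.le⟩
    by_contra hn
    have hji : σ j < σ i := lt_of_le_of_ne (not_lt.1 hn) fun e => hij.ne' (σ.injective e)
    have := hg' _ _ hji ((hg hji.le).antisymm h).symm
    rw [Equiv.Perm.inv_def, Equiv.symm_apply_apply, Equiv.symm_apply_apply] at this
    exact this.not_gt hij
  refine ⟨?_, ?_, ?_⟩
  · rintro ⟨σ, f, g⟩ ⟨⟨hf, hf'⟩, hg⟩ i j hij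
    exact ⟨hf hij.le, fun e => (hlt σ g hg i j hij).2 (hf' i j hij e.symm)⟩
  · rintro ⟨σ, f, g⟩ ⟨-, hg⟩ ⟨σ', f', g'⟩ ⟨-, hg'⟩ h
    simp only at hg hg'
    have h1 : f = f' := funext fun i => (Prod.ext_iff.1 (congrFun h i)).1
    have h2 : g ∘ σ = g' ∘ σ' := funext fun i => (Prod.ext_iff.1 (congrFun h i)).2
    have h3 : σ = σ' := by
      rw [compat_inv_iff_eq_sort] at hg hg'
      rw [h2, ← hg'] at hg
      exact inv_injective hg
    subst h3
    have h4 : g = g' := by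
      funext i
      simpa using congrFun h2 (σ⁻¹ i)
    rw [h1, h4]
  · intro h hh
    set σ : Equiv.Perm (Fin n) := (Tuple.sort (OrderDual.toDual ∘ Prod.snd ∘ h))⁻¹ with hσ
    set g : Fin n → ℕ := fun i => (h (σ⁻¹ i)).2 with hg
    have hgσ : g ∘ σ = Prod.snd ∘ h := by
      funext i
      simp [hg]
    have hcompat : Compat σ⁻¹ g := by
      rw [compat_inv_iff_eq_sort, hgσ, hσ, inv_inv]
    refine ⟨(σ, fun i => (h i).1, g), ⟨⟨?_, ?_⟩, hcompat⟩, ?_⟩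
    · intro i j hij
      rcases hij.eq_or_lt with rfl | hij
      · exact le_rfl
      · exact (hh i j hij).1
    · intro i j hij e
      refine (hlt σ g hcompat i j hij).1 ?_
      have h1 := congrFun hgσ i
      have h2 := congrFun hgσ j
      simp only [Function.comp_apply] at h1 h2
      simp only [h1, h2]
      exact (hh i j hij).2 e.symm
    · funext i
      exact Prod.ext rfl (congrFun hgσ i)

/-- The sequence of columns attached to a permutation and two weakly decreasing sequences. -/
def colSeqOfPerm {n : ℕ} (z : Equiv.Perm (Fin n) × (Fin n → ℕ) × (Fin n → ℕ)) : Fin n → ℕ × ℕ :=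
  colSeq (z.1, z.2.1 + descentsFrom z.1, z.2.2 + descentsFrom z.1⁻¹)

theorem bijOn_colSeqOfPerm (n : ℕ) :
    Set.BijOn colSeqOfPerm {z : Equiv.Perm (Fin n) × (Fin n → ℕ) × (Fin n → ℕ) |
        Antitone z.2.1 ∧ Antitone z.2.2}
      {h | ∀ i j, i < j → ColGE (h i) (h j)} := by
  refine (bijOn_colSeq n).comp (f := fun z : Equiv.Perm (Fin n) × (Fin n → ℕ) × (Fin n → ℕ) => (z.1, z.2.1 + descentsFrom z.1,
    z.2.2 + descentsFrom z.1⁻¹)) ⟨?_, ?_, ?_⟩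
  · rintro ⟨σ, l, m⟩ ⟨hl, hm⟩
    exact ⟨(bijOn_add_descentsFrom σ).mapsTo hl, (bijOn_add_descentsFrom σ⁻¹).mapsTo hm⟩
  · rintro ⟨σ, l, m⟩ - ⟨σ', l', m'⟩ - h
    simp only [Prod.mk.injEq] at h
    obtain ⟨rfl, h1, h2⟩ := h
    rw [add_right_cancel h1, add_right_cancel h2]
  · rintro ⟨σ, f, g⟩ ⟨hf, hg⟩
    obtain ⟨l, hl, h1⟩ := (bijOn_add_descentsFrom σ).surjOn hf
    obtain ⟨m, hm, h2⟩ := (bijOn_add_descentsFrom σ⁻¹).surjOn hg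
    refine ⟨(σ, l, m), ⟨hl, hm⟩, ?_⟩
    simp only at h1 h2
    simp only [h1, h2]

theorem sum_colSeqOfPerm {n : ℕ} (z : Equiv.Perm (Fin n) × (Fin n → ℕ) × (Fin n → ℕ)) :
    ∑ i, colSeqOfPerm z i = (maj z.1, maj z.1⁻¹) + (∑ i, z.2.1 i, ∑ i, z.2.2 i) := by
  refine Prod.ext ?_ ?_
  · simp [Prod.fst_sum, colSeqOfPerm, colSeq, Finset.sum_add_distrib, sum_descentsFrom, add_comm]
  · simp only [Prod.snd_sum, colSeqOfPerm, colSeq]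
    rw [Equiv.sum_comp z.1 (z.2.2 + descentsFrom z.1⁻¹)]
    simp [Finset.sum_add_distrib, sum_descentsFrom, add_comm]

/-! ### Comparison of the two convolutions. -/

theorem ncard_sorted_columns (n a b : ℕ) :
    {h : Fin n → ℕ × ℕ | (∀ i j, i < j → ColGE (h i) (h j)) ∧ ∑ i, h i = (a, b)}.ncard =
    ∑ i ∈ Finset.HasAntidiagonal.antidiagonal a, ∑ j ∈ Finset.HasAntidiagonal.antidiagonal b,
      {σ : Equiv.Perm (Fin n) | σ ∈ Set.univ ∧ (maj σ, maj σ⁻¹) = (i.1, j.1)}.ncard *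
        ({l : Fin n → ℕ | l ∈ {l | Antitone l} ∧ ∑ k, l k = i.2}.ncard *
          {l : Fin n → ℕ | l ∈ {l | Antitone l} ∧ ∑ k, l k = j.2}.ncard) := by
  have hfin : ∀ v, {l : Fin n → ℕ | l ∈ {l | Antitone l} ∧ ∑ k, l k = v}.Finite := fun v =>
    (Set.finite_Iic (fun _ => v)).subset fun l hl k =>
      hl.2 ▸ Finset.single_le_sum (f := l) (fun _ _ => Nat.zero_le _) (Finset.mem_univ k)
  refine Eq.trans ?_ (ncard_convolution Set.univ {l : Fin n → ℕ | Antitone l}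
    (fun σ : Equiv.Perm (Fin n) => (maj σ, maj σ⁻¹)) (fun l => ∑ k, l k)
    (fun _ => Set.toFinite _) hfin a b)
  obtain ⟨h1, h2, h3⟩ := bijOn_colSeqOfPerm n
  refine (Set.ncard_congr' (Set.BijOn.equiv colSeqOfPerm ⟨?_, ?_, ?_⟩)).symm
  · rintro z ⟨-, hl, hm, hs⟩
    exact ⟨h1 ⟨hl, hm⟩, by rw [sum_colSeqOfPerm, hs]⟩
  · refine h2.mono ?_
    rintro z ⟨-, hl, hm, -⟩
    exact ⟨hl, hm⟩
  · rintro h ⟨hh, hs⟩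
    obtain ⟨z, ⟨hl, hm⟩, rfl⟩ := h3 hh
    exact ⟨z, ⟨trivial, hl, hm, by rw [← hs, sum_colSeqOfPerm]⟩, rfl⟩

/-- A partition of `i ≤ n` has at most `n` parts, so padding by zeros loses nothing and the count no
longer depends on `n`. -/
theorem ncard_antitone_sum_eq {n i : ℕ} (hi : i ≤ n) :
    {l : Fin n → ℕ | l ∈ {l | Antitone l} ∧ ∑ k, l k = i}.ncard =
      {m : Multiset ℕ | 0 ∉ m ∧ m.sum = i}.ncard := by
  rw [← ncard_padded n i, ← ncard_sorted_sum_eq (· ≥ ·) n i]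
  · congr 1
    ext l
    refine and_congr_left fun _ => ⟨fun h i j hij => h hij.le, fun h i j hij => ?_⟩
    rcases hij.eq_or_lt with rfl | hij
    · exact le_rfl
    · exact h i j hij
  · intro m h0 hs
    have := card_le_of_forall_pos (AddMonoidHom.id ℕ) m
      fun x hx => Nat.pos_of_ne_zero fun e => h0 (e ▸ hx)
    simp only [AddMonoidHom.id_apply] at this
    omega

theorem ncard_perm_maj_eq {n a b : ℕ} (hab : a + b ≤ n) :
    {σ : Equiv.Perm (Fin n) | σ ∈ Set.univ ∧ (maj σ, maj σ⁻¹) = (a, b)}.ncard =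
      (ColMultisets a b).ncard := by
  refine eq_of_convolution_eq
    (fun a b => {σ : Equiv.Perm (Fin n) | σ ∈ Set.univ ∧ (maj σ, maj σ⁻¹) = (a, b)}.ncard)
    (fun a b => (ColMultisets a b).ncard)
    (fun i => {m : Multiset ℕ | 0 ∉ m ∧ m.sum = i}.ncard) ?_ n ?_ a b hab
  · have : {m : Multiset ℕ | 0 ∉ m ∧ m.sum = 0} = {0} := by
      ext m
      simp only [Set.mem_ofPred_eq, Set.mem_singleton_iff, Multiset.sum_eq_zero_iff]
      refine ⟨fun h => Multiset.eq_zero_of_forall_notMem fun x hx => h.1 (h.2 x hx ▸ hx), ?_⟩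
      rintro rfl
      simp
    simp [this]
  · intro a b hab
    rw [← ncard_multisets_sum_eq, ← ncard_padded n, ← ncard_sorted_sum_eq ColGE n,
      ncard_sorted_columns]
    · refine Finset.sum_congr rfl fun i hi => Finset.sum_congr rfl fun j hj => ?_
      rw [Finset.HasAntidiagonal.mem_antidiagonal] at hi hj
      rw [ncard_antitone_sum_eq (by omega), ncard_antitone_sum_eq (by omega)]
    -- A nonzero column has weight at least one, so there are at most `a + b ≤ n` of them and
    -- padding to `n` is possible.
    · intro m h0 hs
      have := card_le_of_forall_pos colWeight m
        fun x hx => colWeight_pos x fun e => h0 (e ▸ hx)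
      rw [hs] at this
      exact this.trans hab

theorem card_MIP (a b : ℕ) : (MIP a b).card = (ColMultisets a b).ncard := by
  rw [← ncard_perm_maj_eq le_rfl, ← Set.ncard_coe_finset]
  congr 1
  ext σ
  simp [MIP]

end RunSorted

theorem mainTheorem7 :
    HasProd (fun p : ℕ+ × ℕ+ => RunSorted.factor p.1 p.2) RunSorted.genFun ∧
    (∀ a b : ℕ, (a = 0 ↔ b = 0) →
      (∃ e : RunSorted.RSW a b ≃ RunSorted.BW a b, ∀ w : RunSorted.RSW a b,
        List.Perm (e w : List (ℕ × ℕ))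
          ((RunSorted.runs (w : List (Fin 2))).map RunSorted.column)) ∧
      (RunSorted.RSW a b).ncard = (RunSorted.MIP a b).card) :=
  ⟨RunSorted.hasProd_factor, fun a b hab =>
    ⟨RunSorted.exists_equiv_RSW_BW hab, by
      rw [RunSorted.ncard_RSW hab, RunSorted.card_MIP a b]⟩⟩
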